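/- Let $L^2(\partial\mathbb D)$ be taken with normalized Lebesgue measure and let $H^2\subset L^2(\partial\mathbb D)$ be the Hardy space (functions whose Fourier coefficients of negative index vanish). For a finite Blaschke product $\alpha(z)=c\prod_{j=1}^m\frac{z-a_j}{1-\overline{a_j}z}$ ($|c|=1$, $|a_j|<1$) let $K_\alpha=H^2\ominus\alpha H^2$ be the model space, $P_\alpha$ the orthogonal projection of $L^2(\partial\mathbb D)$ onto $K_\alpha$, $C_\alpha f(z)=\alpha(z)\overline{z}\,\overline{f(z)}$ ($|z|=1$) the conjugation on $K_\alpha$, $k_0^\alpha(z)=1-\overline{\alpha(0)}\alpha(z)$ and $\widetilde k_0^\alpha=C_\alpha k_0^\alpha$, i.e. $\widetilde k_0^\alpha(z)=\frac{\alpha(z)-\alpha(0)}{z}$. Write $f\otimes g$ for the rank-one operator $h\mapsto\langle h,g\rangle f$, and for $c\in\mathbb C$ let $S_{\alpha,c}=S_\alpha+c\,(k_0^\alpha\otimes\widetilde k_0^\alpha)$ be the modified compressed shift on $K_\alpha$, where $S_\alpha f=P_\alpha(zf)$. For two finite Blaschke products $\alpha,\beta$ let $\mathscr T(\alpha,\beta)$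 be the set of all bounded linear operators $A\colon K_\alpha\to K_\beta$ for which there is $\varphi\in L^2(\partial\mathbb D)$ with $Af=P_\beta(\varphi f)$ for all bounded $f\in K_\alpha$. Let $\alpha,\beta$ be finite Blaschke products, let $a,b\in\mathbb C$, and let $A\colon K_\alpha\to K_\beta$ be a linear operator. Then: (i) $A\in\mathscr T(\alpha,\beta)$ if and only if there are $\chi\in K_\alpha$ and $\psi\in K_\beta$ such that $$A-S_{\beta,b}^{*}AS_{\alpha,a}=\psi\otimes\widetilde k_0^\alpha+\widetilde k_0^\beta\otimes\chi;$$ (ii) $A\in\mathscr T(\alpha,\beta)$ if and only if $C_\beta AC_\alpha\in\mathscr T(\alpha,\beta)$. -/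

import Mathlib

open MeasureTheory AddCircle
open scoped Real ComplexConjugate ENNReal

noncomputable section

/-- A finite Blaschke product
`z ↦ c * ∏ j, (z - a j) / (1 - conj (a j) * z)`, with `|c| = 1` and `|a j| < 1`. -/
structure FiniteBlaschkeProduct where
  /-- the number of zeros, with multiplicity -/
  degree : ℕ
  /-- the unimodular constant factor -/
  const : ℂ
  norm_const : ‖const‖ = 1
  /-- the zeros, repeated according to multiplicity -/
  zeros : Fin degree → ℂ
  norm_zeros_lt_one : ∀ j, ‖zeros j‖ < 1

namespace FiniteBlaschkeProduct

/-- The function defined by a finite Blaschke product. -/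
def toFun (α : FiniteBlaschkeProduct) (z : ℂ) : ℂ :=
  α.const * ∏ j, (z - α.zeros j) / (1 - conj (α.zeros j) * z)

instance : CoeFun FiniteBlaschkeProduct (fun _ => ℂ → ℂ) := ⟨toFun⟩

theorem denom_ne_zero {a z : ℂ} (ha : ‖a‖ < 1) (hz : ‖z‖ ≤ 1) : 1 - conj a * z ≠ 0 := by
  intro h
  have h1 : conj a * z = 1 := (sub_eq_zero.mp h).symm
  have h2 : ‖a‖ * ‖z‖ = 1 := by simpa using congrArg norm h1
  nlinarith [norm_nonneg a, norm_nonneg z]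

theorem differentiableAt (α : FiniteBlaschkeProduct) {z : ℂ} (hz : ‖z‖ ≤ 1) :
    DifferentiableAt ℂ α z := by
  unfold toFun
  refine DifferentiableAt.const_mul (DifferentiableAt.fun_finsetProd fun j _ => ?_) _
  refine DifferentiableAt.fun_div (by fun_prop) (by fun_prop) ?_
  exact denom_ne_zero (α.norm_zeros_lt_one j) hz

theorem norm_eq_one (α : FiniteBlaschkeProduct) {z : ℂ} (hz : ‖z‖ = 1) : ‖α z‖ = 1 := by
  unfold toFun
  rw [norm_mul, α.norm_const, norm_prod, one_mul]
  refine Finset.prod_eq_one fun j _ => ?_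
  have hne := denom_ne_zero (α.norm_zeros_lt_one j) hz.le
  rw [norm_div, div_eq_one_iff_eq (norm_ne_zero_iff.mpr hne)]
  have hz' : z * conj z = 1 := by rw [Complex.mul_conj, Complex.normSq_eq_norm_sq, hz]; simp
  have h1 : 1 - conj (α.zeros j) * z = z * conj (z - α.zeros j) := by
    rw [map_sub, mul_sub, hz']; ring
  rw [h1, norm_mul, hz, one_mul, Complex.norm_conj]

end FiniteBlaschkeProduct

instance fact_two_pi_pos : Fact (0 < 2 * π) := ⟨Real.two_pi_pos⟩

/-- The unit circle `∂𝔻`, parametrized by `t ↦ exp (i t)`, `t ∈ ℝ / 2πℤ`. It is used with the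
normalized Lebesgue measure `haarAddCircle`; `fourier n` is the function `zⁿ`. -/
abbrev UnitCirc := AddCircle (2 * π)

/-- `L²(∂𝔻)`. -/
abbrev L2Circ := Lp ℂ 2 (haarAddCircle : Measure UnitCirc)

/-- Multiplication by a continuous function on `L²(∂𝔻)`. -/
def mulOp (u : C(UnitCirc, ℂ)) : L2Circ →L[ℂ] L2Circ :=
  (ContinuousLinearMap.mul ℂ ℂ).holderL haarAddCircle ∞ 2 2
    (ContinuousMap.toLp ∞ haarAddCircle ℂ u)

theorem coeFn_mulOp (u : C(UnitCirc, ℂ)) (f : L2Circ) :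
    mulOp u f =ᵐ[haarAddCircle] fun t => u t * f t := by
  have h := (ContinuousLinearMap.mul ℂ ℂ).coeFn_holder (r := 2)
    (ContinuousMap.toLp ∞ haarAddCircle ℂ u) f
  filter_upwards [h, ContinuousMap.coeFn_toLp (p := ∞) (𝕜 := ℂ) haarAddCircle u] with t h1 h2
  rw [← h2]
  exact h1

theorem mulOp_mulOp (u v : C(UnitCirc, ℂ)) (f : L2Circ) :
    mulOp u (mulOp v f) = mulOp (u * v) f := by
  apply Lp.ext
  filter_upwards [coeFn_mulOp u (mulOp v f), coeFn_mulOp v f, coeFn_mulOp (u * v) f]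
    with t h1 h2 h3
  rw [h1, h2, h3, ContinuousMap.mul_apply, mul_assoc]

theorem mulOp_one (f : L2Circ) : mulOp 1 f = f := by
  apply Lp.ext
  filter_upwards [coeFn_mulOp 1 f] with t h1
  rw [h1, ContinuousMap.one_apply, one_mul]

theorem mulOp_toLp (u v : C(UnitCirc, ℂ)) :
    mulOp u (ContinuousMap.toLp 2 haarAddCircle ℂ v)
      = ContinuousMap.toLp 2 haarAddCircle ℂ (u * v) := by
  apply Lp.ext
  filter_upwards [coeFn_mulOp u (ContinuousMap.toLp 2 haarAddCircle ℂ v),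
    ContinuousMap.coeFn_toLp (p := 2) (𝕜 := ℂ) haarAddCircle v,
    ContinuousMap.coeFn_toLp (p := 2) (𝕜 := ℂ) haarAddCircle (u * v)] with t h1 h2 h3
  rw [h1, h2, h3, ContinuousMap.mul_apply]

theorem inner_mulOp_left (u : C(UnitCirc, ℂ)) (f g : L2Circ) :
    inner ℂ (mulOp u f) g = inner ℂ f (mulOp (star u) g) := by
  rw [L2.inner_def, L2.inner_def]
  apply integral_congr_ae
  filter_upwards [coeFn_mulOp u f, coeFn_mulOp (star u) g] with t h1 h2
  rw [h1, h2]
  simp only [RCLike.inner_apply', map_mul, ContinuousMap.star_apply, RCLike.star_def]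
  ring

theorem inner_mulOp_star (u : C(UnitCirc, ℂ)) (f g : L2Circ) :
    inner ℂ g (mulOp u (star f)) = inner ℂ f (mulOp u (star g)) := by
  rw [L2.inner_def, L2.inner_def]
  apply integral_congr_ae
  filter_upwards [coeFn_mulOp u (star f), coeFn_mulOp u (star g), Lp.coeFn_star f,
    Lp.coeFn_star g] with t h1 h2 h3 h4
  rw [h1, h2, h3, h4]
  simp only [RCLike.inner_apply', Pi.star_apply, RCLike.star_def]
  ring

theorem inner_fourierLp (n : ℤ) (f : L2Circ) :
    inner ℂ (fourierLp 2 n) f = fourierCoeff f n := by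
  rw [← fourierBasis_repr, fourierBasis.repr_apply_apply, coe_fourierBasis]

/-- The Hardy space `H²`, regarded as the closed subspace of `L²(∂𝔻)` of all functions whose
Fourier coefficients of negative index vanish. -/
def hardySpace : Submodule ℂ L2Circ where
  carrier := {f | ∀ n : ℤ, n < 0 → fourierCoeff f n = 0}
  zero_mem' n _ := by rw [← inner_fourierLp, inner_zero_right]
  add_mem' {f g} hf hg n hn := by
    rw [← inner_fourierLp, inner_add_right, inner_fourierLp, inner_fourierLp, hf n hn, hg n hn,
      add_zero]
  smul_mem' c f hf n hn := by
    rw [← inner_fourierLp, inner_smul_right, inner_fourierLp, hf n hn, mul_zero]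

theorem mem_hardySpace {f : L2Circ} :
    f ∈ hardySpace ↔ ∀ n : ℤ, n < 0 → fourierCoeff f n = 0 := Iff.rfl

theorem isClosed_hardySpace : IsClosed (hardySpace : Set L2Circ) := by
  have : (hardySpace : Set L2Circ)
      = ⋂ n : ℤ, ⋂ _ : n < 0, {f | inner ℂ (fourierLp 2 n) f = (0 : ℂ)} := by
    ext f
    simp [mem_hardySpace, inner_fourierLp]
  rw [this]
  exact isClosed_iInter fun n => isClosed_iInter fun _ =>
    isClosed_eq (by fun_prop) continuous_const

theorem fourierLp_mem_hardySpace {n : ℤ} (hn : 0 ≤ n) : fourierLp 2 n ∈ hardySpace := by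
  intro k hk
  rw [← inner_fourierLp]
  exact orthonormal_fourier.inner_eq_zero (by omega)

/-- An element of `H²` is orthogonal to every element of `L²(∂𝔻)` whose Fourier coefficients of
nonnegative index vanish. -/
theorem inner_eq_zero_of_mem_hardySpace {h g : L2Circ} (hh : h ∈ hardySpace)
    (hg : ∀ n : ℤ, 0 ≤ n → fourierCoeff g n = 0) : inner ℂ h g = (0 : ℂ) := by
  have key := fourierBasis.hasSum_inner_mul_inner h g
  rw [coe_fourierBasis] at key
  refine key.unique ?_
  convert! hasSum_zero (α := ℂ) (β := ℤ) using 1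
  funext n
  rw [inner_fourierLp]
  rcases lt_or_ge n 0 with hn | hn
  · rw [← inner_conj_symm, inner_fourierLp, hh n hn, map_zero, zero_mul]
  · rw [hg n hn, mul_zero]

namespace FiniteBlaschkeProduct

variable (α β : FiniteBlaschkeProduct)

/-- The restriction of a finite Blaschke product to the unit circle. -/
def boundary : C(UnitCirc, ℂ) where
  toFun t := α (toCircle t)
  continuous_toFun := by
    rw [continuous_iff_continuousAt]
    intro t
    have h1 : ContinuousAt α (toCircle t : ℂ) :=
      (α.differentiableAt (Circle.norm_coe _).le).continuousAt
    exact ContinuousAt.comp (f := fun t : UnitCirc => (toCircle t : ℂ)) h1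
      (continuous_subtype_val.comp continuous_toCircle).continuousAt

theorem boundary_apply (t : UnitCirc) : α.boundary t = α (toCircle t) := rfl

theorem star_boundary_mul : star α.boundary * α.boundary = 1 := by
  ext t
  have h : ‖α.boundary t‖ = 1 := by
    rw [boundary_apply]; exact α.norm_eq_one (Circle.norm_coe _)
  simp only [ContinuousMap.mul_apply, ContinuousMap.star_apply, RCLike.star_def,
    ContinuousMap.one_apply]
  rw [mul_comm, Complex.mul_conj, Complex.normSq_eq_norm_sq, h]; simp

theorem integral_boundary_mul_fourier (k : ℕ) :
    ∫ t, α.boundary t * fourier (k : ℤ) t ∂haarAddCircle = α 0 * 0 ^ k := by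
  have hd : DiffContOnCl ℂ (fun z => α z * z ^ k) (Metric.ball 0 |1|) := by
    refine DifferentiableOn.diffContOnCl fun z hz => ?_
    have hz' : ‖z‖ ≤ 1 := by
      have := Metric.closure_ball_subset_closedBall hz
      simpa using this
    exact ((α.differentiableAt hz').mul (by fun_prop)).differentiableWithinAt
  have h1 := hd.circleAverage
  rw [Real.circleAverage_def] at h1
  rw [integral_haarAddCircle, ← AddCircle.intervalIntegral_preimage (2 * π) 0, ← h1, zero_add]
  congr 1
  apply intervalIntegral.integral_congr
  intro θ _
  have : (toCircle (θ : UnitCirc) : ℂ) = circleMap 0 1 θ := by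
    rw [toCircle_apply_mk, Circle.coe_exp, circleMap]
    have : (2 * π / (2 * π) : ℝ) = 1 := div_self Real.two_pi_pos.ne'
    rw [this]; simp
  simp only [boundary_apply, fourier_apply, this, natCast_zsmul, toCircle_nsmul, Circle.coe_pow]

/-- The Fourier coefficients of nonpositive index of `α h`, for `h ∈ H²`. -/
theorem inner_fourierLp_mulOp {h : L2Circ} (hh : h ∈ hardySpace) (k : ℕ) :
    inner ℂ (fourierLp 2 (-(k : ℤ))) (mulOp α.boundary h)
      = α 0 * 0 ^ k * fourierCoeff h 0 := by
  have hs := hasSum_fourier_series_L2 h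
  have hs' := hs.mapL (innerSL ℂ (fourierLp 2 (-(k : ℤ))) ∘L mulOp α.boundary)
  simp only [map_smul, ContinuousLinearMap.comp_apply, innerSL_apply_apply] at hs'
  refine hs'.unique ?_
  have hval : ∀ i : ℕ, inner ℂ (fourierLp 2 (-(k : ℤ)) : L2Circ)
      (mulOp α.boundary (fourierLp 2 (i : ℤ))) = α 0 * 0 ^ (k + i) := by
    intro i
    rw [← α.integral_boundary_mul_fourier, L2.inner_def]
    apply integral_congr_ae
    filter_upwards [coeFn_mulOp α.boundary (fourierLp 2 (i : ℤ)), coeFn_fourierLp 2 (i : ℤ),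
      coeFn_fourierLp 2 (-(k : ℤ))] with t h1 h2 h3
    rw [h1, h2, h3, RCLike.inner_apply', ← fourier_neg, neg_neg, Nat.cast_add, fourier_add]
    ring
  have h0 := hval 0
  rw [add_zero, Nat.cast_zero] at h0
  rw [← h0, mul_comm (inner ℂ _ _)]
  refine hasSum_single (0 : ℤ) fun i hi => ?_
  rcases lt_or_ge i 0 with hneg | hpos
  · rw [hh i hneg, zero_smul]
  · obtain ⟨j, rfl⟩ := Int.eq_ofNat_of_zero_le hpos
    have hj : k + j ≠ 0 := by
      have : j ≠ 0 := by rintro rfl; exact hi rfl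
      omega
    rw [hval j, zero_pow hj, mul_zero, smul_zero]

theorem inner_mulOp_boundary (f g : L2Circ) :
    inner ℂ (mulOp α.boundary f) (mulOp α.boundary g) = inner ℂ f g := by
  rw [inner_mulOp_left, mulOp_mulOp, star_boundary_mul, mulOp_one]

/-- The model space `K_α = H² ⊖ α H²`. -/
def modelSpace : Submodule ℂ L2Circ :=
  hardySpace ⊓ (hardySpace.map (mulOp α.boundary).toLinearMap)ᗮ

theorem mem_modelSpace {f : L2Circ} : f ∈ α.modelSpace ↔
    f ∈ hardySpace ∧ ∀ h ∈ hardySpace, inner ℂ (mulOp α.boundary h) f = (0 : ℂ) := by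
  rw [modelSpace, Submodule.mem_inf, Submodule.mem_orthogonal]
  refine and_congr_right fun _ => ⟨fun H h hh => H _ ⟨h, hh, rfl⟩, ?_⟩
  rintro H _ ⟨h, hh, rfl⟩
  exact H h hh

instance : CompleteSpace α.modelSpace := by
  have : IsClosed (α.modelSpace : Set L2Circ) :=
    isClosed_hardySpace.inter (Submodule.isClosed_orthogonal _)
  exact this.completeSpace_coe

/-- The orthogonal projection `P_α` of `L²(∂𝔻)` onto `K_α`. -/
def proj : L2Circ →L[ℂ] α.modelSpace := α.modelSpace.orthogonalProjectionOnto

/-- The kernel function `k₀(z) = 1 - conj (α 0) * α z`, an element of `L²(∂𝔻)`. -/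
def kernelFun : L2Circ :=
  ContinuousMap.toLp 2 haarAddCircle ℂ (1 - conj (α 0) • α.boundary)

theorem kernelFun_eq : α.kernelFun
    = fourierLp 2 0 - conj (α 0) • mulOp α.boundary (fourierLp 2 0) := by
  have h1 : (fourier 0 : C(UnitCirc, ℂ)) = 1 := by ext t; simp
  rw [fourierLp, mulOp_toLp, h1, mul_one, ← map_smul, ← map_sub, kernelFun]

theorem kernelFun_mem : α.kernelFun ∈ α.modelSpace := by
  have h0 : (fourierLp 2 0 : L2Circ) ∈ hardySpace := fourierLp_mem_hardySpace le_rfl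
  rw [kernelFun_eq, mem_modelSpace]
  constructor
  · refine hardySpace.sub_mem h0 (hardySpace.smul_mem _ fun n hn => ?_)
    obtain ⟨k, hk⟩ := Int.exists_eq_neg_ofNat hn.le
    have hk0 : k ≠ 0 := by rintro rfl; simp at hk; omega
    rw [← inner_fourierLp, hk, α.inner_fourierLp_mulOp h0, zero_pow hk0, mul_zero, zero_mul]
  · intro h hh
    have h1 := α.inner_fourierLp_mulOp hh 0
    rw [Nat.cast_zero, neg_zero, pow_zero, mul_one] at h1
    rw [inner_sub_right, inner_smul_right, inner_mulOp_boundary,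
      ← inner_conj_symm, h1, ← inner_conj_symm h, inner_fourierLp, map_mul, sub_self]

/-- The kernel function `k₀` as an element of `K_α`. -/
def kernel : α.modelSpace := ⟨α.kernelFun, α.kernelFun_mem⟩

/-- The conjugation `C_α f (z) = α z * conj z * conj (f z)`, `|z| = 1`, on `L²(∂𝔻)`. -/
def conjL2 : L2Circ →ₛₗ[starRingEnd ℂ] L2Circ where
  toFun f := mulOp (α.boundary * fourier (-1)) (star f)
  map_add' f g := by
    rw [← map_add]
    congr 1
    apply Lp.ext
    filter_upwards [Lp.coeFn_star (f + g), Lp.coeFn_add f g, Lp.coeFn_add (star f) (star g),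
      Lp.coeFn_star f, Lp.coeFn_star g] with t h1 h2 h3 h4 h5
    rw [h1, h3, Pi.star_apply, h2, Pi.add_apply, Pi.add_apply, h4, h5, star_add]
    rfl
  map_smul' c f := by
    rw [← map_smul]
    congr 1
    apply Lp.ext
    filter_upwards [Lp.coeFn_star (c • f), Lp.coeFn_smul c f,
      Lp.coeFn_smul (starRingEnd ℂ c) (star f), Lp.coeFn_star f] with t h1 h2 h3 h4
    rw [h1, h3, Pi.star_apply, h2, Pi.smul_apply, Pi.smul_apply, h4, star_smul]
    rfl

theorem conjL2_apply (f : L2Circ) :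
    α.conjL2 f = mulOp (α.boundary * fourier (-1)) (star f) := rfl

theorem star_toLp (u : C(UnitCirc, ℂ)) :
    star (ContinuousMap.toLp 2 haarAddCircle ℂ u : L2Circ)
      = ContinuousMap.toLp 2 haarAddCircle ℂ (star u) := by
  apply Lp.ext
  filter_upwards [Lp.coeFn_star (ContinuousMap.toLp 2 haarAddCircle ℂ u),
    ContinuousMap.coeFn_toLp (p := 2) (𝕜 := ℂ) haarAddCircle u,
    ContinuousMap.coeFn_toLp (p := 2) (𝕜 := ℂ) haarAddCircle (star u)] with t h1 h2 h3
  rw [h1, h3, Pi.star_apply, h2, ContinuousMap.star_apply]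

theorem star_mulOp (u : C(UnitCirc, ℂ)) (f : L2Circ) :
    star (mulOp u f) = mulOp (star u) (star f) := by
  apply Lp.ext
  filter_upwards [Lp.coeFn_star (mulOp u f), coeFn_mulOp u f, coeFn_mulOp (star u) (star f),
    Lp.coeFn_star f] with t h1 h2 h3 h4
  rw [h1, h3, Pi.star_apply, h2, h4, ContinuousMap.star_apply, star_mul', Pi.star_apply]

theorem star_fourier (n : ℤ) : star (fourier n : C(UnitCirc, ℂ)) = fourier (-n) := by
  ext t
  rw [ContinuousMap.star_apply, fourier_neg, RCLike.star_def]

theorem fourier_mul_fourier (m n : ℤ) :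
    (fourier m * fourier n : C(UnitCirc, ℂ)) = fourier (m + n) := by
  ext t
  rw [ContinuousMap.mul_apply, fourier_add]

theorem conjL2_mem {f : L2Circ} (hf : f ∈ α.modelSpace) : α.conjL2 f ∈ α.modelSpace := by
  rw [mem_modelSpace] at hf ⊢
  obtain ⟨hf1, hf2⟩ := hf
  constructor
  · intro n hn
    rw [← inner_fourierLp, conjL2_apply, inner_mulOp_star, fourierLp, star_toLp, star_fourier,
      mulOp_toLp, mul_assoc, fourier_mul_fourier, ← mulOp_toLp, ← inner_conj_symm]
    have := hf2 (fourierLp 2 (-1 + -n)) (fourierLp_mem_hardySpace (by omega))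
    rw [fourierLp] at this
    rw [this, map_zero]
  · intro h hh
    have hu : α.boundary * fourier (-1) * star α.boundary = fourier (-1) := by
      rw [mul_right_comm, mul_comm α.boundary, star_boundary_mul, one_mul]
    rw [conjL2_apply, inner_mulOp_star, star_mulOp, mulOp_mulOp, hu]
    refine inner_eq_zero_of_mem_hardySpace hf1 fun n hn => ?_
    rw [← inner_fourierLp, inner_mulOp_star, fourierLp, star_toLp, star_fourier,
      mulOp_toLp, fourier_mul_fourier, ← inner_conj_symm]
    have := hh (-1 + -n) (by omega)
    rw [← inner_fourierLp, fourierLp] at this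
    rw [this, map_zero]

/-- The conjugation `C_α` on `K_α`. -/
def conjugation : α.modelSpace →ₛₗ[starRingEnd ℂ] α.modelSpace :=
  α.conjL2.restrict fun _ hf => α.conjL2_mem hf

/-- The conjugate kernel function `k̃₀ = C_α k₀`, that is, `k̃₀(z) = (α z - α 0) / z`. -/
def conjKernel : α.modelSpace := α.conjugation α.kernel

/-- The compressed shift `S_α f = P_α (z f)` on `K_α`. -/
def compressedShift : α.modelSpace →L[ℂ] α.modelSpace :=
  α.proj ∘L mulOp (fourier 1) ∘L α.modelSpace.subtypeL

/-- The modified compressed shift `S_{α,c} = S_α + c (k₀ ⊗ k̃₀)`; here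
`InnerProductSpace.rankOne ℂ f g` is the operator `f ⊗ g : h ↦ ⟨h, g⟩ f`. -/
def modifiedShift (c : ℂ) : α.modelSpace →L[ℂ] α.modelSpace :=
  α.compressedShift + c • InnerProductSpace.rankOne ℂ α.kernel α.conjKernel

/-- The product `φ f ∈ L²(∂𝔻)` of `φ ∈ L²(∂𝔻)` and a bounded `f ∈ L²(∂𝔻)`. -/
def mulBdd (φ f : L2Circ) (hf : MemLp f ∞ haarAddCircle) : L2Circ :=
  (hf.mul (r := 2) (Lp.memLp φ)).toLp (φ * f)

/-- `𝒯(α, β)`: the bounded linear operators `A : K_α → K_β` that are given on the bounded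
functions in `K_α` by `A f = P_β (φ f)`, for some `φ ∈ L²(∂𝔻)`. -/
def truncatedToeplitz : Set (α.modelSpace →ₗ[ℂ] β.modelSpace) :=
  {A | Continuous A ∧ ∃ φ : L2Circ, ∀ (f : α.modelSpace)
    (hf : MemLp (f : L2Circ) ∞ haarAddCircle), A f = β.proj (mulBdd φ f hf)}

end FiniteBlaschkeProduct

end

/-!
For the compressed shifts `S_α` and `S_β`, the displacement map `A ↦ A - S_β* A S_α` is injective,
because the powers of a compressed shift tend to `0`: `S_α ^ n f` differs from `z ^ n * f` only by
an element of `α H²`, the functions `z ^ n * f` tend weakly to `0`, and `K_α` is finite-dimensional,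
since multiplication by the denominator of `α` maps it to polynomials of degree less than that of
`α`. The displacement of the truncated Toeplitz operator with symbol `φ` has the form `ψ ⊗ k̃_α +
k̃_β ⊗ χ`. Conversely, the symbols `conj α * z * ψ` and `C_β χ` give the displacements `ψ ⊗ k̃_α`
and `k̃_β ⊗ χ`, so injectivity makes every operator with a displacement of this form truncated
Toeplitz. Replacing the shifts by `S_{α,a}` and `S_{β,b}` changes the displacement only by operators
of the same form. Finally, `C_β A C_α` has symbol `β * conj α * conj φ` if `A` has symbol `φ`.
-/

section Displacement

open Filter InnerProductSpace
open scoped Topology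

variable {𝕜 E F : Type*} [RCLike 𝕜] [NormedAddCommGroup E] [InnerProductSpace 𝕜 E]
  [NormedAddCommGroup F] [InnerProductSpace 𝕜 F]

theorem tendsto_inner_cofinite_of_orthonormal {ι : Type*} {v : ι → E} (hv : Orthonormal 𝕜 v)
    (x : E) : Tendsto (fun i => inner 𝕜 x (v i)) cofinite (𝓝 0) := by
  have hsq := (hv.inner_products_summable (x := x)).tendsto_cofinite_zero
  rw [tendsto_zero_iff_norm_tendsto_zero]
  simpa [Real.sqrt_sq_eq_abs, norm_inner_symm x] using hsq.sqrt

theorem tendsto_of_forall_tendsto_inner [FiniteDimensional 𝕜 E] {ι : Type*} {l : Filter ι}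
    {u : ι → E} {x : E} (h : ∀ y, Tendsto (fun i => inner 𝕜 y (u i)) l (𝓝 (inner 𝕜 y x))) :
    Tendsto u l (𝓝 x) := by
  let e := stdOrthonormalBasis 𝕜 E
  have hsum : Tendsto (fun i => ∑ j, inner 𝕜 (e j) (u i) • e j) l
      (𝓝 (∑ j, inner 𝕜 (e j) x • e j)) :=
    tendsto_finsetSum _ fun j _ => (h (e j)).smul_const _
  simpa only [e.sum_repr'] using hsum

/-- The operators `ψ ⊗ l + n ⊗ χ`, for fixed vectors `l` and `n`. Rank-one modifications of the
shifts change the displacement of an operator only by elements of such a subspace. -/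
def rankTwoSubmodule (l : E) (n : F) : Submodule 𝕜 (E →L[𝕜] F) where
  carrier := {B | ∃ (χ : E) (ψ : F), B = rankOne 𝕜 ψ l + rankOne 𝕜 n χ}
  zero_mem' := ⟨0, 0, by simp⟩
  add_mem' := by
    rintro _ _ ⟨χ, ψ, rfl⟩ ⟨χ', ψ', rfl⟩
    refine ⟨χ + χ', ψ + ψ', ?_⟩
    rw [map_add, map_add, _root_.add_apply]
    abel
  smul_mem' := by
    rintro c _ ⟨χ, ψ, rfl⟩
    exact ⟨conj c • χ, c • ψ, by simp⟩

theorem rankOne_mem_rankTwoSubmodule_left (ψ n : F) (l : E) :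
    rankOne 𝕜 ψ l ∈ rankTwoSubmodule l n :=
  ⟨0, ψ, by simp⟩

theorem rankOne_mem_rankTwoSubmodule_right (n : F) (l χ : E) :
    rankOne 𝕜 n χ ∈ rankTwoSubmodule l n :=
  ⟨χ, 0, by simp⟩

variable [CompleteSpace F]

/-- The displacement map `A ↦ A - T* A S` of a pair of operators `S` and `T`; truncated Toeplitz
operators are recognized by their displacement. -/
noncomputable def displacement (S : E →L[𝕜] E) (T : F →L[𝕜] F) :
    (E →L[𝕜] F) →ₗ[𝕜] (E →L[𝕜] F) where
  toFun A := A - ContinuousLinearMap.adjoint T ∘L A ∘L S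
  map_add' A B := by
    rw [ContinuousLinearMap.add_comp, ContinuousLinearMap.comp_add]
    abel
  map_smul' c A := by
    rw [ContinuousLinearMap.smul_comp, ContinuousLinearMap.comp_smul, smul_sub, RingHom.id_apply]

theorem displacement_apply (S : E →L[𝕜] E) (T : F →L[𝕜] F) (A : E →L[𝕜] F) :
    displacement S T A = A - ContinuousLinearMap.adjoint T ∘L A ∘L S := rfl

theorem inner_eq_inner_pow_of_displacement_eq_zero {S : E →L[𝕜] E} {T : F →L[𝕜] F}
    {A : E →L[𝕜] F} (hA : displacement S T A = 0) (n : ℕ) (x : E) (y : F) :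
    inner 𝕜 y (A x) = inner 𝕜 ((T ^ n) y) (A ((S ^ n) x)) := by
  induction n with
  | zero => simp
  | succ n ih =>
    have hfix : A ((S ^ n) x) = ContinuousLinearMap.adjoint T (A (S ((S ^ n) x))) :=
      DFunLike.congr_fun (sub_eq_zero.mp hA) ((S ^ n) x)
    rw [ih, hfix, ContinuousLinearMap.adjoint_inner_right, pow_succ', pow_succ',
      _root_.mul_apply_eq_comp, _root_.mul_apply_eq_comp]

theorem displacement_injective {S : E →L[𝕜] E} {T : F →L[𝕜] F}
    (hS : ∀ x, Tendsto (fun n : ℕ => (S ^ n) x) atTop (𝓝 0))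
    (hT : ∀ y, Tendsto (fun n : ℕ => (T ^ n) y) atTop (𝓝 0)) :
    Function.Injective (displacement S T) := by
  refine (injective_iff_map_eq_zero _).mpr fun A hA => ?_
  ext x
  refine ext_inner_left 𝕜 fun y => ?_
  have hlim : Tendsto (fun n : ℕ => inner 𝕜 ((T ^ n) y) (A ((S ^ n) x))) atTop
      (𝓝 (inner 𝕜 0 (A 0))) :=
    (hT y).inner ((A.continuous.tendsto 0).comp (hS x))
  rw [inner_zero_left] at hlim
  rw [_root_.zero_apply, inner_zero_right]
  exact tendsto_nhds_unique (tendsto_const_nhds.congr fun n =>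
    inner_eq_inner_pow_of_displacement_eq_zero hA n x y) hlim

variable [CompleteSpace E]

theorem displacement_sub_displacement_add_rankOne_mem (S : E →L[𝕜] E) (T : F →L[𝕜] F)
    (A : E →L[𝕜] F) (k l : E) (m n : F) (a b : 𝕜) :
    displacement S T A - displacement (S + a • rankOne 𝕜 k l) (T + b • rankOne 𝕜 m n) A
      ∈ rankTwoSubmodule l n := by
  set S' := S + a • rankOne 𝕜 k l with hS'
  have hsplit : displacement S T A - displacement S' (T + b • rankOne 𝕜 m n) A
      = a • rankOne 𝕜 (ContinuousLinearMap.adjoint T (A k)) l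
        + conj b • rankOne 𝕜 n (ContinuousLinearMap.adjoint (A ∘L S') m) := by
    rw [← rankOne_comp, ← comp_rankOne, ← comp_rankOne]
    simp only [displacement_apply, map_add, map_smulₛₗ, adjoint_rankOne,
      ContinuousLinearMap.add_comp, ContinuousLinearMap.comp_add, ContinuousLinearMap.smul_comp,
      ContinuousLinearMap.comp_smul, hS']
    module
  rw [hsplit]
  exact add_mem (Submodule.smul_mem _ _ (rankOne_mem_rankTwoSubmodule_left _ _ _))
    (Submodule.smul_mem _ _ (rankOne_mem_rankTwoSubmodule_right _ _ _))

theorem displacement_add_rankOne_mem_iff (S : E →L[𝕜] E) (T : F →L[𝕜] F)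
    (A : E →L[𝕜] F) (k l : E) (m n : F) (a b : 𝕜) :
    displacement (S + a • rankOne 𝕜 k l) (T + b • rankOne 𝕜 m n) A ∈ rankTwoSubmodule l n ↔
      displacement S T A ∈ rankTwoSubmodule l n := by
  have hdiff := displacement_sub_displacement_add_rankOne_mem S T A k l m n a b
  exact ⟨fun h => by simpa using add_mem hdiff h, fun h => by simpa using sub_mem h hdiff⟩

end Displacement

section Circle

open Filter
open scoped Topology

theorem mem_span_fourierLp {T : ℝ} [Fact (0 < T)] {s : Finset ℤ}
    {f : Lp ℂ 2 (haarAddCircle : Measure (AddCircle T))}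
    (hf : ∀ n ∉ s, fourierCoeff f n = 0) :
    f ∈ Submodule.span ℂ (fourierLp 2 '' (s : Set ℤ)) := by
  have hsum : f = ∑ n ∈ s, fourierCoeff f n • fourierLp 2 n :=
    (hasSum_fourier_series_L2 f).unique
      (hasSum_sum_of_ne_finset_zero fun n hn => by rw [hf n hn, zero_smul])
  rw [hsum]
  exact Submodule.sum_mem _ fun n hn =>
    Submodule.smul_mem _ _ (Submodule.subset_span (Set.mem_image_of_mem _ hn))

theorem fourier_zero_eq_one {T : ℝ} : (fourier 0 : C(AddCircle T, ℂ)) = 1 := by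
  ext t
  exact fourier_zero

/-- A continuous function on the circle, as an element of `L²(∂𝔻)`. -/
noncomputable abbrev toL2 (u : C(UnitCirc, ℂ)) : L2Circ := ContinuousMap.toLp 2 haarAddCircle ℂ u

theorem mulOp_add (u v : C(UnitCirc, ℂ)) (f : L2Circ) :
    mulOp (u + v) f = mulOp u f + mulOp v f := by
  simp [mulOp]

theorem mulOp_sub (u v : C(UnitCirc, ℂ)) (f : L2Circ) :
    mulOp (u - v) f = mulOp u f - mulOp v f := by
  simp [mulOp]

theorem mulOp_smul (c : ℂ) (u : C(UnitCirc, ℂ)) (f : L2Circ) :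
    mulOp (c • u) f = c • mulOp u f := by
  simp [mulOp]

theorem inner_mulOp_right (u : C(UnitCirc, ℂ)) (f g : L2Circ) :
    inner ℂ f (mulOp u g) = inner ℂ (mulOp (star u) f) g := by
  rw [inner_mulOp_left, star_star]

theorem fourierCoeff_mulOp_fourier (m n : ℤ) (f : L2Circ) :
    fourierCoeff (mulOp (fourier m) f) n = fourierCoeff f (n - m) := by
  rw [← inner_fourierLp, ← inner_fourierLp, inner_mulOp_right, fourierLp, mulOp_toLp,
    FiniteBlaschkeProduct.star_fourier, FiniteBlaschkeProduct.fourier_mul_fourier,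
    neg_add_eq_sub, fourierLp]

theorem inner_fourierLp_star (n : ℤ) (f : L2Circ) :
    inner ℂ (fourierLp 2 n) (star f) = conj (fourierCoeff f (-n)) := by
  have h := inner_mulOp_star 1 f (fourierLp 2 n)
  rwa [mulOp_one, mulOp_one, fourierLp, FiniteBlaschkeProduct.star_toLp,
    FiniteBlaschkeProduct.star_fourier, ← inner_conj_symm f, ← fourierLp, ← fourierLp,
    inner_fourierLp (-n)] at h

theorem inner_toL2_one (f : L2Circ) : inner ℂ (toL2 1) f = fourierCoeff f 0 := by
  rw [← inner_fourierLp, fourierLp, fourier_zero_eq_one]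

theorem fourierCoeff_toL2_one : fourierCoeff (toL2 1) 0 = 1 := by
  rw [← inner_fourierLp, ← fourier_zero_eq_one]
  exact inner_self_eq_one_of_norm_eq_one (orthonormal_fourier.norm_eq_one 0)

theorem tendsto_inner_mulOp_fourier (g : L2Circ) (u : C(UnitCirc, ℂ)) :
    Tendsto (fun n : ℕ => inner ℂ g (mulOp (fourier n) (toL2 u))) atTop (𝓝 0) := by
  have hcoeff : ∀ n : ℕ, inner ℂ g (mulOp (fourier n) (toL2 u))
      = inner ℂ (mulOp (star u) g) (fourierLp 2 (n : ℤ)) := fun n => by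
    rw [← inner_mulOp_right, mulOp_toLp, fourierLp, mulOp_toLp, mul_comm u]
  simp only [hcoeff]
  have hcast : Tendsto (Nat.cast : ℕ → ℤ) atTop cofinite :=
    Nat.cofinite_eq_atTop ▸ Nat.cast_injective.tendsto_cofinite
  exact (tendsto_inner_cofinite_of_orthonormal orthonormal_fourier _).comp hcast

theorem inner_star_of_mem_hardySpace {f g : L2Circ} (hf : f ∈ hardySpace) (hg : g ∈ hardySpace) :
    inner ℂ f (star g) = conj (fourierCoeff f 0 * fourierCoeff g 0) := by
  have hterm : ∀ n : ℤ, inner ℂ f (fourierLp 2 n) * inner ℂ (fourierLp 2 n) (star g)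
      = conj (fourierCoeff f n * fourierCoeff g (-n)) := fun n => by
    rw [inner_fourierLp_star, ← inner_conj_symm, inner_fourierLp, map_mul]
  have hparseval := fourierBasis.hasSum_inner_mul_inner f (star g)
  simp only [coe_fourierBasis, hterm] at hparseval
  refine hparseval.unique ?_
  convert! hasSum_single (0 : ℤ) fun n hn => ?_ using 2
  rcases hn.lt_or_gt with hneg | hpos
  · rw [hf n hneg, zero_mul, map_zero]
  · rw [hg (-n) (by omega), mul_zero, map_zero]

theorem toL2_one_mem_hardySpace : toL2 1 ∈ hardySpace := by
  rw [← fourier_zero_eq_one]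
  exact fourierLp_mem_hardySpace le_rfl

/-- The continuous functions on the circle by which `H²` can be multiplied (they are the boundary
values of the disc algebra). -/
noncomputable def hardyMultiplier : Subalgebra ℂ C(UnitCirc, ℂ) where
  carrier := {u | ∀ f ∈ hardySpace, mulOp u f ∈ hardySpace}
  mul_mem' {u v} hu hv f hf := by
    rw [← mulOp_mulOp]
    exact hu _ (hv _ hf)
  add_mem' {u v} hu hv f hf := by
    rw [mulOp_add]
    exact add_mem (hu _ hf) (hv _ hf)
  algebraMap_mem' c f hf := by
    rw [Algebra.algebraMap_eq_smul_one, mulOp_smul, mulOp_one]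
    exact Submodule.smul_mem _ _ hf

theorem fourier_mem_hardyMultiplier {m : ℤ} (hm : 0 ≤ m) : fourier m ∈ hardyMultiplier := by
  intro f hf n hn
  rw [fourierCoeff_mulOp_fourier]
  exact hf _ (by omega)

theorem toL2_mem_hardySpace {u : C(UnitCirc, ℂ)} (hu : u ∈ hardyMultiplier) :
    toL2 u ∈ hardySpace := by
  rw [toL2, ← mul_one u, ← mulOp_toLp]
  exact hu _ toL2_one_mem_hardySpace

end Circle

noncomputable section

namespace FiniteBlaschkeProduct

open Filter InnerProductSpace
open scoped Topology

variable (α β : FiniteBlaschkeProduct)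

theorem boundary_mul_star : α.boundary * star α.boundary = 1 := by
  rw [mul_comm α.boundary, star_boundary_mul]

theorem boundary_mem_hardyMultiplier : α.boundary ∈ hardyMultiplier := by
  intro h hh n hn
  obtain ⟨k, rfl⟩ := Int.exists_eq_neg_ofNat hn.le
  rw [← inner_fourierLp, α.inner_fourierLp_mulOp hh, zero_pow (by omega), mul_zero, zero_mul]

/-- The denominator `∏ j, (1 - conj (a j) * z)` of a finite Blaschke product, on the circle. -/
def denom : C(UnitCirc, ℂ) := ∏ j, (1 - conj (α.zeros j) • fourier 1)

theorem denom_apply (t : UnitCirc) :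
    α.denom t = ∏ j, (1 - conj (α.zeros j) * (toCircle t : ℂ)) := by
  simp [denom, ContinuousMap.prod_apply]

theorem isUnit_denom : IsUnit α.denom := by
  rw [ContinuousMap.isUnit_iff_forall_ne_zero]
  intro t
  rw [denom_apply]
  exact Finset.prod_ne_zero_iff.mpr fun j _ =>
    denom_ne_zero (α.norm_zeros_lt_one j) (Circle.norm_coe _).le

theorem denom_mem_hardyMultiplier : α.denom ∈ hardyMultiplier :=
  prod_mem fun _ _ => sub_mem (one_mem _)
    (Subalgebra.smul_mem _ (fourier_mem_hardyMultiplier zero_le_one) _)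

/-- On the circle `z - a = z * conj (1 - conj a * z)`. -/
theorem boundary_mul_denom :
    α.boundary * α.denom = α.const • (fourier α.degree * star α.denom) := by
  ext t
  have hne : ∀ j, 1 - conj (α.zeros j) * (toCircle t : ℂ) ≠ 0 := fun j =>
    denom_ne_zero (α.norm_zeros_lt_one j) (Circle.norm_coe _).le
  have hz : (toCircle t : ℂ) * conj (toCircle t : ℂ) = 1 := by
    rw [Complex.mul_conj, Circle.normSq_coe, Complex.ofReal_one]
  have hpow : (fourier α.degree t : ℂ) = ∏ _j : Fin α.degree, (toCircle t : ℂ) := by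
    simp [fourier_apply, toCircle_nsmul]
  simp only [ContinuousMap.mul_apply, ContinuousMap.smul_apply, ContinuousMap.star_apply,
    boundary_apply, toFun, denom_apply, hpow, smul_eq_mul, RCLike.star_def, map_prod, mul_assoc,
    ← Finset.prod_mul_distrib, div_mul_cancel₀ _ (hne _)]
  congr 1
  refine Finset.prod_congr rfl fun j _ => ?_
  simp only [map_sub, map_one, map_mul, Complex.conj_conj]
  linear_combination α.zeros j * hz

theorem fourierCoeff_mulOp_denom {f : L2Circ} (hf : f ∈ α.modelSpace) {n : ℤ}
    (hn : α.degree ≤ n) : fourierCoeff (mulOp α.denom f) n = 0 := by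
  have hconst : α.const ≠ 0 := norm_ne_zero_iff.mp (α.norm_const ▸ one_ne_zero)
  have hsplit : α.const • (star α.denom * fourier n)
      = α.boundary * (α.denom * fourier (n - α.degree)) := by
    rw [← mul_assoc, boundary_mul_denom, smul_mul_assoc, mul_right_comm, fourier_mul_fourier,
      add_sub_cancel, mul_comm (star α.denom)]
  have horth : inner ℂ (α.const • mulOp (star α.denom) (fourierLp 2 n)) f = 0 := by
    rw [fourierLp, mulOp_toLp, ← map_smul, hsplit, ← mulOp_toLp]
    exact (α.mem_modelSpace.mp hf).2 _ (toL2_mem_hardySpace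
      (mul_mem α.denom_mem_hardyMultiplier (fourier_mem_hardyMultiplier (by omega))))
  rwa [inner_smul_left, mul_eq_zero_iff_left ((map_ne_zero _).mpr hconst), ← inner_mulOp_right,
    inner_fourierLp] at horth

theorem mulOp_denom_mem_span {f : L2Circ} (hf : f ∈ α.modelSpace) :
    mulOp α.denom f ∈ Submodule.span ℂ (fourierLp 2 '' (Finset.Ico 0 (α.degree : ℤ) : Set ℤ)) := by
  refine mem_span_fourierLp fun n hn => ?_
  rw [Finset.mem_Ico, not_and_or, not_le, not_lt] at hn
  exact hn.elim (α.denom_mem_hardyMultiplier f hf.1 n) (α.fourierCoeff_mulOp_denom hf)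

theorem modelSpace_le_span : α.modelSpace ≤ Submodule.span ℂ
    ((fun n : ℤ => toL2 (Ring.inverse α.denom * fourier n)) '' Finset.Ico 0 (α.degree : ℤ)) := by
  intro f hf
  have hmem := Submodule.mem_map_of_mem (f := (mulOp (Ring.inverse α.denom)).toLinearMap)
    (α.mulOp_denom_mem_span hf)
  rw [Submodule.map_span, Set.image_image] at hmem
  simpa only [ContinuousLinearMap.coe_coe, mulOp_mulOp, Ring.inverse_mul_cancel _ α.isUnit_denom,
    mulOp_one, fourierLp, mulOp_toLp] using hmem

instance finiteDimensional_modelSpace : FiniteDimensional ℂ α.modelSpace :=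
  have := FiniteDimensional.span_of_finite ℂ ((Finset.Ico 0 (α.degree : ℤ)).finite_toSet.image
    fun n : ℤ => toL2 (Ring.inverse α.denom * fourier n))
  Submodule.finiteDimensional_of_le α.modelSpace_le_span

theorem modelSpace_le_range_toLp :
    α.modelSpace ≤ (ContinuousMap.toLp 2 haarAddCircle ℂ).toLinearMap.range := by
  refine α.modelSpace_le_span.trans (Submodule.span_le.mpr ?_)
  rintro _ ⟨n, -, rfl⟩
  exact ⟨_, rfl⟩

/-- The continuous representative of an element of the model space. -/
def continuousRep : α.modelSpace →ₗ[ℂ] C(UnitCirc, ℂ) :=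
  (LinearEquiv.ofInjective (ContinuousMap.toLp 2 haarAddCircle ℂ).toLinearMap
    (ContinuousMap.toLp_injective haarAddCircle)).symm.toLinearMap ∘ₗ
      Submodule.inclusion α.modelSpace_le_range_toLp

theorem toL2_continuousRep (f : α.modelSpace) : toL2 (α.continuousRep f) = f :=
  congrArg Subtype.val (LinearEquiv.apply_symm_apply
    (LinearEquiv.ofInjective (ContinuousMap.toLp 2 haarAddCircle ℂ).toLinearMap
      (ContinuousMap.toLp_injective haarAddCircle))
    (Submodule.inclusion α.modelSpace_le_range_toLp f))

theorem continuousRep_eq {f : α.modelSpace} {u : C(UnitCirc, ℂ)} (hu : (f : L2Circ) = toL2 u) :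
    α.continuousRep f = u :=
  ContinuousMap.toLp_injective haarAddCircle ((α.toL2_continuousRep f).trans hu)

theorem inner_proj (g : α.modelSpace) (x : L2Circ) :
    inner ℂ g (α.proj x) = inner ℂ (g : L2Circ) x :=
  Submodule.inner_orthogonalProjectionOnto_eq_of_mem_left g x

theorem proj_coe (f : α.modelSpace) : α.proj f = f :=
  Submodule.orthogonalProjectionOnto_mem_subspace_eq_self f

theorem conjugation_coe (f : α.modelSpace) : (α.conjugation f : L2Circ) = α.conjL2 f := rfl

theorem star_conjL2 (f : L2Circ) :
    star (α.conjL2 f) = mulOp (star α.boundary * fourier 1) f := by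
  rw [conjL2_apply, star_mulOp, star_star, star_mul', star_fourier, neg_neg]

theorem conjL2_mulOp (u : C(UnitCirc, ℂ)) (f : L2Circ) :
    α.conjL2 (mulOp u f) = mulOp (star u) (α.conjL2 f) := by
  rw [conjL2_apply, conjL2_apply, star_mulOp, mulOp_mulOp, mulOp_mulOp, mul_comm (star u)]

theorem conjL2_toL2 (u : C(UnitCirc, ℂ)) :
    α.conjL2 (toL2 u) = toL2 (α.boundary * fourier (-1) * star u) := by
  rw [conjL2_apply, star_toLp, mulOp_toLp]

theorem conjL2_conjL2 (f : L2Circ) : α.conjL2 (α.conjL2 f) = f := by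
  have hunimodular : α.boundary * fourier (-1) * (star α.boundary * fourier 1) = 1 := by
    rw [mul_mul_mul_comm, boundary_mul_star, fourier_mul_fourier, neg_add_cancel,
      fourier_zero_eq_one, one_mul]
  rw [conjL2_apply, star_conjL2, mulOp_mulOp, hunimodular, mulOp_one]

theorem conjugation_conjugation (f : α.modelSpace) : α.conjugation (α.conjugation f) = f :=
  Subtype.ext (α.conjL2_conjL2 f)

theorem inner_conjL2_right (f g : L2Circ) :
    inner ℂ f (α.conjL2 g) = inner ℂ g (α.conjL2 f) :=
  inner_mulOp_star _ _ _

theorem inner_conjL2_left (f g : L2Circ) :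
    inner ℂ (α.conjL2 f) g = inner ℂ (α.conjL2 g) f := by
  rw [← inner_conj_symm, inner_conjL2_right, inner_conj_symm]

theorem conjugation_proj (x : L2Circ) : α.conjugation (α.proj x) = α.proj (α.conjL2 x) := by
  refine ext_inner_left ℂ fun g => ?_
  calc inner ℂ g (α.conjugation (α.proj x))
      = inner ℂ (α.proj x) (α.conjugation g) := α.inner_conjL2_right _ _
    _ = inner ℂ x (α.conjL2 g) :=
        Submodule.inner_orthogonalProjectionOnto_eq_of_mem_right _ _
    _ = inner ℂ g (α.proj (α.conjL2 x)) := by rw [inner_conjL2_right, inner_proj]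

theorem inner_kernel (f : α.modelSpace) : inner ℂ α.kernel f = fourierCoeff (f : L2Circ) 0 := by
  have horth : inner ℂ (mulOp α.boundary (fourierLp 2 0)) (f : L2Circ) = 0 :=
    (α.mem_modelSpace.mp f.2).2 _ (fourierLp_mem_hardySpace le_rfl)
  calc inner ℂ α.kernel f = inner ℂ α.kernelFun (f : L2Circ) := rfl
    _ = fourierCoeff (f : L2Circ) 0 := by
        rw [kernelFun_eq, inner_sub_left, inner_smul_left, horth, mul_zero, sub_zero,
          inner_fourierLp]

theorem inner_conjKernel (f : α.modelSpace) :
    inner ℂ α.conjKernel f = conj (fourierCoeff (α.conjL2 f) 0) := by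
  calc inner ℂ α.conjKernel f = inner ℂ (α.conjugation f) α.kernel := α.inner_conjL2_left _ _
    _ = conj (fourierCoeff (α.conjL2 f) 0) := by
        rw [← inner_conj_symm (E := α.modelSpace), inner_kernel, conjugation_coe]

theorem inner_mulOp_boundary_mulOp_fourier_one {h : L2Circ} (hh : h ∈ hardySpace)
    (f : α.modelSpace) :
    inner ℂ (mulOp α.boundary h) (mulOp (fourier 1) f)
      = conj (fourierCoeff h 0) * inner ℂ α.conjKernel f := by
  rw [inner_mulOp_left, mulOp_mulOp, ← star_conjL2,
    inner_star_of_mem_hardySpace hh (α.conjL2_mem f.2).1, map_mul, inner_conjKernel]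

theorem inner_toL2_boundary_mulOp_fourier_one (f : α.modelSpace) :
    inner ℂ (toL2 α.boundary) (mulOp (fourier 1) f) = inner ℂ α.conjKernel f := by
  have h := α.inner_mulOp_boundary_mulOp_fourier_one toL2_one_mem_hardySpace f
  rwa [mulOp_toLp, mul_one, fourierCoeff_toL2_one, map_one, one_mul] at h

theorem proj_mulOp_fourier_neg_one_mul_boundary {h : L2Circ} (hh : h ∈ hardySpace) :
    α.proj (mulOp (fourier (-1) * α.boundary) h) = fourierCoeff h 0 • α.conjKernel := by
  refine ext_inner_left ℂ fun g => ?_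
  rw [inner_proj, ← mulOp_mulOp, inner_mulOp_right, star_fourier, neg_neg, ← inner_conj_symm,
    inner_mulOp_boundary_mulOp_fourier_one _ hh, map_mul, Complex.conj_conj,
    inner_conj_symm (E := α.modelSpace), inner_smul_right (E := α.modelSpace)]

theorem coe_compressedShift (f : α.modelSpace) :
    (α.compressedShift f : L2Circ)
      = mulOp (fourier 1) f - inner ℂ α.conjKernel f • toL2 α.boundary := by
  have hboundary : toL2 α.boundary = mulOp α.boundary (toL2 1) := by rw [mulOp_toLp, mul_one]
  refine Submodule.eq_starProjection_of_mem_of_inner_eq_zero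
    (α.mem_modelSpace.mpr ⟨?_, fun h hh => ?_⟩) fun g hg => ?_
  · exact sub_mem (fourier_mem_hardyMultiplier zero_le_one _ f.2.1)
      (Submodule.smul_mem _ _ (toL2_mem_hardySpace α.boundary_mem_hardyMultiplier))
  · rw [inner_sub_right, inner_mulOp_boundary_mulOp_fourier_one _ hh, inner_smul_right, hboundary,
      inner_mulOp_boundary, ← inner_conj_symm h, inner_toL2_one, mul_comm (conj _), sub_self]
  · change inner ℂ (mulOp (fourier 1) (f : L2Circ) - _) g = 0
    rw [sub_sub_cancel, inner_smul_left, hboundary,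
      (α.mem_modelSpace.mp hg).2 _ toL2_one_mem_hardySpace, mul_zero]

theorem exists_coe_compressedShift_pow (f : α.modelSpace) (n : ℕ) :
    ∃ h ∈ hardySpace, ((α.compressedShift ^ n) f : L2Circ)
      = mulOp (fourier n) f - mulOp α.boundary h := by
  induction n with
  | zero => exact ⟨0, zero_mem _, by simp [fourier_zero_eq_one, mulOp_one]⟩
  | succ n ih =>
    obtain ⟨h, hh, hn⟩ := ih
    set g := (α.compressedShift ^ n) f with hg
    refine ⟨mulOp (fourier 1) h + inner ℂ α.conjKernel g • toL2 1,
      add_mem (fourier_mem_hardyMultiplier zero_le_one h hh)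
        (Submodule.smul_mem _ _ toL2_one_mem_hardySpace), ?_⟩
    rw [pow_succ', _root_.mul_apply_eq_comp, ← hg, coe_compressedShift, hn, map_sub, map_add,
      map_smul, mulOp_toLp, mul_one, mulOp_mulOp, mulOp_mulOp, mulOp_mulOp, fourier_mul_fourier,
      Nat.cast_succ, add_comm (n : ℤ), mul_comm α.boundary (fourier 1), sub_sub]

theorem tendsto_compressedShift_pow (f : α.modelSpace) :
    Tendsto (fun n : ℕ => (α.compressedShift ^ n) f) atTop (𝓝 0) := by
  refine tendsto_of_forall_tendsto_inner (𝕜 := ℂ) fun g => ?_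
  rw [inner_zero_right]
  refine (tendsto_inner_mulOp_fourier g (α.continuousRep f)).congr fun n => ?_
  obtain ⟨h, hh, hn⟩ := α.exists_coe_compressedShift_pow f n
  have horth : inner ℂ (g : L2Circ) (mulOp α.boundary h) = 0 :=
    inner_eq_zero_symm.mp ((α.mem_modelSpace.mp g.2).2 h hh)
  rw [Submodule.coe_inner, hn, inner_sub_right, horth, sub_zero, toL2_continuousRep]

theorem adjoint_compressedShift_proj (x : L2Circ) :
    ContinuousLinearMap.adjoint α.compressedShift (α.proj x)
      = α.proj (mulOp (fourier (-1)) x) - inner ℂ (toL2 α.boundary) x • α.conjKernel := by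
  refine ext_inner_left ℂ fun g => ?_
  rw [ContinuousLinearMap.adjoint_inner_right, inner_proj, coe_compressedShift, inner_sub_left,
    inner_smul_left, inner_mulOp_left, star_fourier, inner_conj_symm (E := α.modelSpace),
    inner_sub_right (E := α.modelSpace), inner_proj, inner_smul_right (E := α.modelSpace),
    mul_comm (inner ℂ g _)]

theorem mulBdd_eq_mulOp (φ : L2Circ) {f : L2Circ} {u : C(UnitCirc, ℂ)} (hu : f = toL2 u)
    (hf : MemLp f ∞ haarAddCircle) : mulBdd φ f hf = mulOp u φ := by
  subst hu
  apply Lp.ext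
  filter_upwards [MemLp.coeFn_toLp (hf.mul (r := 2) (Lp.memLp φ)), coeFn_mulOp u φ,
    ContinuousMap.coeFn_toLp (p := 2) (𝕜 := ℂ) haarAddCircle u] with t hmul hmulOp hu
  rw [hmulOp, ← hu]
  exact hmul.trans (mul_comm _ _)

theorem memLp_top_toL2 (u : C(UnitCirc, ℂ)) : MemLp (toL2 u) ∞ haarAddCircle :=
  (Lp.memLp (ContinuousMap.toLp ∞ haarAddCircle ℂ u)).ae_eq
    ((ContinuousMap.coeFn_toLp (𝕜 := ℂ) haarAddCircle u).trans
      (ContinuousMap.coeFn_toLp (𝕜 := ℂ) haarAddCircle u).symm)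

/-- The truncated Toeplitz operator `f ↦ P_β (φ f)` with symbol `φ`. It is defined on all of `K_α`
because every element of `K_α` is continuous. -/
def toeplitz : L2Circ →ₗ[ℂ] α.modelSpace →L[ℂ] β.modelSpace where
  toFun φ := LinearMap.toContinuousLinearMap
    { toFun := fun f => β.proj (mulOp (α.continuousRep f) φ)
      map_add' := fun f g => by rw [map_add, mulOp_add, map_add]
      map_smul' := fun c f => by rw [map_smul, mulOp_smul, map_smul, RingHom.id_apply] }
  map_add' φ θ := by
    ext1 f
    change β.proj _ = β.proj _ + β.proj _
    rw [map_add, map_add]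
  map_smul' c φ := by
    ext1 f
    change β.proj _ = c • β.proj _
    rw [map_smul, map_smul]

variable {α} in
theorem toeplitz_apply (φ : L2Circ) {f : α.modelSpace} {u : C(UnitCirc, ℂ)}
    (hu : (f : L2Circ) = toL2 u) : α.toeplitz β φ f = β.proj (mulOp u φ) := by
  rw [← α.continuousRep_eq hu]
  rfl

variable {α} in
theorem proj_mulBdd (φ : L2Circ) (f : α.modelSpace) (hf : MemLp (f : L2Circ) ∞ haarAddCircle) :
    β.proj (mulBdd φ f hf) = α.toeplitz β φ f := by
  have hrep := (α.toL2_continuousRep f).symm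
  rw [mulBdd_eq_mulOp φ hrep, toeplitz_apply β φ hrep]

theorem memLp_top_modelSpace (f : α.modelSpace) : MemLp (f : L2Circ) ∞ haarAddCircle :=
  α.toL2_continuousRep f ▸ memLp_top_toL2 _

variable {α β} in
theorem mem_truncatedToeplitz_iff {A : α.modelSpace →ₗ[ℂ] β.modelSpace} :
    A ∈ α.truncatedToeplitz β ↔ ∃ φ, ∀ f, α.toeplitz β φ f = A f := by
  constructor
  · rintro ⟨-, φ, hφ⟩
    exact ⟨φ, fun f =>
      ((hφ f (α.memLp_top_modelSpace f)).trans (proj_mulBdd β φ f _)).symm⟩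
  · rintro ⟨φ, hφ⟩
    exact ⟨A.continuous_of_finiteDimensional, φ, fun f hf =>
      ((proj_mulBdd β φ f hf).trans (hφ f)).symm⟩

theorem conjugation_toeplitz_conjugation (φ : L2Circ) (f : α.modelSpace) :
    β.conjugation (α.toeplitz β φ (α.conjugation f))
      = α.toeplitz β (mulOp (β.boundary * star α.boundary) (star φ)) f := by
  have hf := (α.toL2_continuousRep f).symm
  have hCf : (α.conjugation f : L2Circ)
      = toL2 (α.boundary * fourier (-1) * star (α.continuousRep f)) := by
    rw [conjugation_coe, hf, conjL2_toL2]
  have hsymbol : star (α.boundary * fourier (-1) * star (α.continuousRep f))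
        * (β.boundary * fourier (-1))
      = α.continuousRep f * (β.boundary * star α.boundary) := by
    have hz : (fourier 1 * fourier (-1) : C(UnitCirc, ℂ)) = 1 := by
      rw [fourier_mul_fourier, add_neg_cancel, fourier_zero_eq_one]
    rw [star_mul', star_mul', star_star, star_fourier, neg_neg]
    linear_combination (star α.boundary * α.continuousRep f * β.boundary) * hz
  rw [toeplitz_apply β φ hCf, toeplitz_apply β _ hf, conjugation_proj, conjL2_mulOp, conjL2_apply,
    mulOp_mulOp, mulOp_mulOp, hsymbol]

variable {α β} in
theorem conjugation_comp_mem_truncatedToeplitz {A : α.modelSpace →ₗ[ℂ] β.modelSpace}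
    (hA : A ∈ α.truncatedToeplitz β) :
    β.conjugation.comp (A.comp α.conjugation) ∈ α.truncatedToeplitz β := by
  obtain ⟨φ, hφ⟩ := mem_truncatedToeplitz_iff.mp hA
  exact mem_truncatedToeplitz_iff.mpr
    ⟨_, fun f => ((conjugation_toeplitz_conjugation α β φ f).symm.trans
      (congrArg β.conjugation (hφ _)))⟩

variable {α β} in
theorem mem_truncatedToeplitz_iff_conjugation_comp_mem {A : α.modelSpace →ₗ[ℂ] β.modelSpace} :
    A ∈ α.truncatedToeplitz β ↔
      β.conjugation.comp (A.comp α.conjugation) ∈ α.truncatedToeplitz β := by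
  refine ⟨conjugation_comp_mem_truncatedToeplitz, fun hA => ?_⟩
  convert conjugation_comp_mem_truncatedToeplitz hA
  ext1 f
  simp only [LinearMap.comp_apply, conjugation_conjugation]

theorem toeplitz_compressedShift (φ : L2Circ) {f : α.modelSpace} {u : C(UnitCirc, ℂ)}
    (hf : (f : L2Circ) = toL2 u) :
    α.toeplitz β φ (α.compressedShift f)
      = β.proj (mulOp (fourier 1 * u) φ - inner ℂ α.conjKernel f • mulOp α.boundary φ) := by
  have hSf : (α.compressedShift f : L2Circ)
      = toL2 (fourier 1 * u - inner ℂ α.conjKernel f • α.boundary) := by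
    rw [coe_compressedShift, hf, mulOp_toLp, toL2, toL2, map_sub, map_smul]
  rw [toeplitz_apply β φ hSf, mulOp_sub, mulOp_smul]

theorem inner_proj_conjL2 (φ : L2Circ) {f : α.modelSpace} {u : C(UnitCirc, ℂ)}
    (hf : (f : L2Circ) = toL2 u) :
    inner ℂ (α.proj (β.conjL2 φ)) f = inner ℂ (toL2 β.boundary) (mulOp (fourier 1 * u) φ) := by
  have hsymbol : star (fourier 1 * u) * β.boundary = β.boundary * fourier (-1) * star u := by
    rw [star_mul', star_fourier]
    ring
  calc inner ℂ (α.proj (β.conjL2 φ)) f = inner ℂ (β.conjL2 φ) (f : L2Circ) :=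
        Submodule.inner_orthogonalProjectionOnto_eq_of_mem_right f _
    _ = inner ℂ (toL2 β.boundary) (mulOp (fourier 1 * u) φ) := by
      rw [hf, inner_conjL2_left, conjL2_toL2, inner_mulOp_right, mulOp_toLp, hsymbol]

theorem displacement_toeplitz_apply (φ : L2Circ) (f : α.modelSpace) :
    displacement α.compressedShift β.compressedShift (α.toeplitz β φ) f
      = inner ℂ α.conjKernel f • (β.proj (mulOp (fourier (-1) * α.boundary) φ)
          - inner ℂ (toL2 β.boundary) (mulOp α.boundary φ) • β.conjKernel)
        + inner ℂ (α.proj (β.conjL2 φ)) f • β.conjKernel := by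
  have hf : (f : L2Circ) = toL2 (α.continuousRep f) := (α.toL2_continuousRep f).symm
  have hshift : fourier (-1) * (fourier 1 * α.continuousRep f) = α.continuousRep f := by
    rw [← mul_assoc, fourier_mul_fourier, neg_add_cancel, fourier_zero_eq_one, one_mul]
  set x := mulOp (fourier 1 * α.continuousRep f) φ - inner ℂ α.conjKernel f • mulOp α.boundary φ
    with hx
  have hbackward : β.proj (mulOp (fourier (-1)) x) = β.proj (mulOp (α.continuousRep f) φ)
      - inner ℂ α.conjKernel f • β.proj (mulOp (fourier (-1) * α.boundary) φ) := by
    have : mulOp (fourier (-1)) x = mulOp (α.continuousRep f) φ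
        - inner ℂ α.conjKernel f • mulOp (fourier (-1) * α.boundary) φ := by
      rw [hx, map_sub, map_smul, mulOp_mulOp, hshift, mulOp_mulOp]
    rw [this, map_sub]
    exact congrArg _ (map_smul _ _ _)
  calc displacement α.compressedShift β.compressedShift (α.toeplitz β φ) f
      = α.toeplitz β φ f
        - ContinuousLinearMap.adjoint β.compressedShift
            (α.toeplitz β φ (α.compressedShift f)) := rfl
    _ = β.proj (mulOp (α.continuousRep f) φ)
        - (β.proj (mulOp (fourier (-1)) x) - inner ℂ (toL2 β.boundary) x • β.conjKernel) :=
      congrArg₂ (· - ·) (toeplitz_apply β φ hf)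
        ((congrArg _ (toeplitz_compressedShift α β φ hf)).trans
          (β.adjoint_compressedShift_proj x))
    _ = _ := by
      rw [hbackward, inner_sub_right, inner_smul_right, inner_proj_conjL2 α β φ hf]
      module

theorem displacement_toeplitz (φ : L2Circ) :
    displacement α.compressedShift β.compressedShift (α.toeplitz β φ)
      = rankOne ℂ (β.proj (mulOp (fourier (-1) * α.boundary) φ)
          - inner ℂ (toL2 β.boundary) (mulOp α.boundary φ) • β.conjKernel) α.conjKernel
        + rankOne ℂ β.conjKernel (α.proj (β.conjL2 φ)) :=
  ContinuousLinearMap.ext (displacement_toeplitz_apply α β φ)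

theorem displacement_toeplitz_eq_rankOne_conjKernel_right (ψ : β.modelSpace) :
    displacement α.compressedShift β.compressedShift
        (α.toeplitz β (mulOp (star α.boundary * fourier 1) ψ))
      = rankOne ℂ ψ α.conjKernel := by
  have hmul : mulOp α.boundary (mulOp (star α.boundary * fourier 1) ψ) = mulOp (fourier 1) ψ := by
    rw [mulOp_mulOp, ← mul_assoc, boundary_mul_star, one_mul]
  have hconj : β.conjL2 (mulOp (star α.boundary * fourier 1) ψ)
      = mulOp (fourier (-1) * α.boundary) (β.conjL2 ψ) := by
    rw [conjL2_mulOp, star_mul', star_star, star_fourier, mul_comm α.boundary]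
  have hproj : α.proj (β.conjL2 (mulOp (star α.boundary * fourier 1) ψ))
      = conj (inner ℂ β.conjKernel ψ) • α.conjKernel := by
    rw [hconj, α.proj_mulOp_fourier_neg_one_mul_boundary (β.conjL2_mem ψ.2).1, inner_conjKernel,
      Complex.conj_conj]
  have hsymbol : mulOp (fourier (-1) * α.boundary) (mulOp (star α.boundary * fourier 1) ψ) = ψ := by
    rw [← mulOp_mulOp, hmul, mulOp_mulOp, fourier_mul_fourier, neg_add_cancel,
      fourier_zero_eq_one, mulOp_one]
  refine ContinuousLinearMap.ext fun f => (displacement_toeplitz_apply α β _ f).trans ?_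
  change _ = inner ℂ α.conjKernel f • ψ
  rw [hsymbol, hproj, hmul, inner_toL2_boundary_mulOp_fourier_one, proj_coe,
    inner_smul_left (E := α.modelSpace), Complex.conj_conj]
  module

theorem displacement_toeplitz_eq_rankOne_conjKernel_left (χ : α.modelSpace) :
    displacement α.compressedShift β.compressedShift (α.toeplitz β (β.conjL2 χ))
      = rankOne ℂ β.conjKernel χ := by
  have hswap : mulOp α.boundary (β.conjL2 χ) = mulOp β.boundary (α.conjL2 χ) := by
    simp only [conjL2_apply, mulOp_mulOp, mul_left_comm α.boundary]
  have hproj : β.proj (mulOp (fourier (-1) * α.boundary) (β.conjL2 χ))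
      = fourierCoeff (α.conjL2 χ) 0 • β.conjKernel := by
    rw [← mulOp_mulOp, hswap, mulOp_mulOp,
      β.proj_mulOp_fourier_neg_one_mul_boundary (α.conjL2_mem χ.2).1]
  have hinner : inner ℂ (toL2 β.boundary) (mulOp α.boundary (β.conjL2 χ))
      = fourierCoeff (α.conjL2 χ) 0 := by
    rw [hswap, inner_mulOp_right, mulOp_toLp, star_boundary_mul, inner_toL2_one]
  refine ContinuousLinearMap.ext fun f => (displacement_toeplitz_apply α β _ f).trans ?_
  change _ = inner ℂ χ f • β.conjKernel
  rw [hproj, hinner, sub_self, smul_zero, zero_add, conjL2_conjL2, proj_coe]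

theorem exists_toeplitz_eq_iff_displacement_mem (A : α.modelSpace →L[ℂ] β.modelSpace) :
    (∃ φ, α.toeplitz β φ = A) ↔
      displacement α.compressedShift β.compressedShift A
        ∈ rankTwoSubmodule α.conjKernel β.conjKernel := by
  constructor
  · rintro ⟨φ, rfl⟩
    exact ⟨_, _, displacement_toeplitz α β φ⟩
  · rintro ⟨χ, ψ, hA⟩
    refine ⟨mulOp (star α.boundary * fourier 1) ψ + β.conjL2 χ,
      displacement_injective α.tendsto_compressedShift_pow β.tendsto_compressedShift_pow ?_⟩
    calc displacement α.compressedShift β.compressedShift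
          (α.toeplitz β (mulOp (star α.boundary * fourier 1) ψ + β.conjL2 χ))
        = displacement α.compressedShift β.compressedShift
            (α.toeplitz β (mulOp (star α.boundary * fourier 1) ψ))
          + displacement α.compressedShift β.compressedShift (α.toeplitz β (β.conjL2 χ)) := by
          rw [map_add]
          exact map_add _ _ _
      _ = rankOne ℂ ψ α.conjKernel + rankOne ℂ β.conjKernel χ :=
          congrArg₂ (· + ·) (displacement_toeplitz_eq_rankOne_conjKernel_right α β ψ)
            (displacement_toeplitz_eq_rankOne_conjKernel_left α β χ)
      _ = displacement α.compressedShift β.compressedShift A := hA.symm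

variable {α β} in
theorem mem_truncatedToeplitz_iff_displacement_mem {A : α.modelSpace →ₗ[ℂ] β.modelSpace}
    (a b : ℂ) :
    A ∈ α.truncatedToeplitz β ↔
      displacement (α.modifiedShift a) (β.modifiedShift b) (LinearMap.toContinuousLinearMap A)
        ∈ rankTwoSubmodule α.conjKernel β.conjKernel := by
  have htoeplitz : A ∈ α.truncatedToeplitz β ↔
      ∃ φ, α.toeplitz β φ = LinearMap.toContinuousLinearMap A :=
    mem_truncatedToeplitz_iff.trans
      (exists_congr fun _ => ⟨fun h => ContinuousLinearMap.ext h, fun h => DFunLike.congr_fun h⟩)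
  have hshift := exists_toeplitz_eq_iff_displacement_mem α β (LinearMap.toContinuousLinearMap A)
  have hmodified := displacement_add_rankOne_mem_iff α.compressedShift β.compressedShift
    (LinearMap.toContinuousLinearMap A) α.kernel α.conjKernel β.kernel β.conjKernel a b
  exact htoeplitz.trans (hshift.trans hmodified.symm)

end FiniteBlaschkeProduct

end

theorem mainTheorem2 (α β : FiniteBlaschkeProduct) (a b : ℂ)
    (A : α.modelSpace →ₗ[ℂ] β.modelSpace) :
    (A ∈ α.truncatedToeplitz β ↔
      ∃ (χ : α.modelSpace) (ψ : β.modelSpace),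
        A - (ContinuousLinearMap.adjoint (β.modifiedShift b)).toLinearMap ∘ₗ A ∘ₗ
            (α.modifiedShift a).toLinearMap =
          (InnerProductSpace.rankOne ℂ ψ α.conjKernel).toLinearMap +
            (InnerProductSpace.rankOne ℂ β.conjKernel χ).toLinearMap) ∧
    (A ∈ α.truncatedToeplitz β ↔
      β.conjugation.comp (A.comp α.conjugation) ∈ α.truncatedToeplitz β) := by
  constructor
  · exact (FiniteBlaschkeProduct.mem_truncatedToeplitz_iff_displacement_mem a b).trans
      (exists₂_congr fun _ _ => ContinuousLinearMap.coe_inj.symm)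
  · exact FiniteBlaschkeProduct.mem_truncatedToeplitz_iff_conjugation_comp_mem
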